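/- Let $N\ge 2$ and let $\mathscr G$ be a weakly connected signed digraph on $\{1,\dots,N\}$ without self-loops, with weighted adjacency matrix $[w_{kl}]\in\mathbb R^{N\times N}$ (there is an edge from $l$ to $k$ iff $w_{kl}\neq 0$). A closed strong component (CSC) is a maximal strongly connected subgraph with no incoming edges from nodes outside it (a single node counts as strongly connected). A subgraph is structurally balanced if its node set splits into two disjoint, possibly empty, classes such that $w_{kl}\ge 0$ for $k,l$ in the same class and $w_{kl}\le 0$ for $k,l$ in different classes; otherwise it is unbalanced. Leaders are the nodes lying in some CSC, all other nodes are followers. Let $\kappa,\rho_1,\rho_2,\mu_2,\mu_3,T_r,T_s,\delta>0$ and $\mu_1>\delta$. For $T>0$ put $\varphi(t,T)=T^\kappa/(T-t)^\kappa$ and $\dot\varphi(t,T)=\frac{\kappa}{T}\varphi(t,T)^{1+1/\kappa}$ for $0\le t<T$, and $\varphi(t,T)=1$, $\dot\varphi(t,T)=0$ for $t\ge T$. Consider the disturbed network $\dot x_k=u_k+d_k(t)$, $k=1,\dots,N$, with $|d_k(t)|\le\delta$ for $t\ge 0$, under the sliding-mode protocol $$u_k=u_k^{dis}+u_k^{nom},\qquad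 \sigma_k=x_k+\varsigma_k,\qquad \dot\varsigma_k=-u_k^{nom},$$ $$u_k^{nom}=\Bigl(\rho_1+\rho_2\tfrac{\dot\varphi(t,T_r+T_s)}{\varphi(t,T_r+T_s)}\Bigr)\sum_{l=1}^N w_{kl}\bigl[x_l-\mathrm{sign}(w_{kl})x_k\bigr],\qquad u_k^{dis}=-\mu_1\,\mathrm{sign}(\sigma_k)-\Bigl(\mu_2+\mu_3\tfrac{\dot\varphi(t,T_r)}{\varphi(t,T_r)}\Bigr)\sigma_k,$$ where solutions $(x,\varsigma)$ on $[0,\infty)$ are understood in the sense of Filippov. Put $T=T_r+T_s$. Then the following hold for all such parameters, disturbances and solutions (hence for all initial values). 1. If at least one CSC of $\mathscr G$ is structurally balanced, the network reaches prescribed-time bipartite containment at $T$: for every structurally balanced CSC there is $x^*\ge 0$ such that each node $k$ of it satisfies $\lim_{t\to T}|x_k(t)|=x^*$ and $|x_k(t)|=x^*$ for all $t\ge T$; each node $k$ of an unbalanced CSC satisfies $\lim_{t\to T}x_k(t)=0$ and $x_k(t)=0$ for all $t\ge T$; and for each follower $l$ the limit $\lim_{t\to T}\bigl[\max_{k\text{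 leader}}|x_k(t)|-|x_l(t)|\bigr]$ exists and is $\ge 0$, and $|x_l(t)|\le\max_{k\text{ leader}}|x_k(t)|$ for all $t\ge T$. Moreover, for every structurally balanced CSC there is a proper linear subspace $Z\subsetneq\mathbb R^N$, depending only on $\mathscr G$ and the CSC, such that $x^*>0$ for that CSC whenever $(\varsigma_1(0),\dots,\varsigma_N(0))\notin Z$. 2. If all CSCs of $\mathscr G$ are structurally unbalanced, the network reaches prescribed-time stability at $T$: for every $k$, $\lim_{t\to T}x_k(t)=0$ and $x_k(t)=0$ for all $t\ge T$. -/

import Mathlib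

open Filter Topology MeasureTheory

/-- A signed digraph of order `N`, given by its weighted adjacency matrix `W`. There is an edge
from `l` to `k` iff `W k l ≠ 0`, and there are no self-loops. -/
structure SignedDigraph (N : ℕ) where
  W : Matrix (Fin N) (Fin N) ℝ
  no_loops : ∀ k, W k k = 0

namespace SignedDigraph

variable {N : ℕ} (G : SignedDigraph N)

/-- `G.Edge a b`: there is a directed edge from `a` to `b`. -/
def Edge (a b : Fin N) : Prop := G.W b a ≠ 0

/-- The underlying undirected graph is connected. -/
def WeaklyConnected : Prop := (SimpleGraph.fromRel G.Edge).Connected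

/-- The subgraph induced on `C` is (nonempty and) strongly connected: any two of its nodes are
joined by a directed path that stays in `C`. A single node counts as strongly connected. -/
def StronglyConnectedOn (C : Set (Fin N)) : Prop :=
  C.Nonempty ∧ ∀ a ∈ C, ∀ b ∈ C,
    Relation.ReflTransGen (fun u v => u ∈ C ∧ v ∈ C ∧ G.Edge u v) a b

/-- `C` is the node set of a closed strong component: a maximal strongly connected subgraph
without incoming edges from nodes outside. -/
def IsClosedStrongComponent (C : Set (Fin N)) : Prop :=
  Maximal G.StronglyConnectedOn C ∧ ∀ k ∈ C, ∀ l ∉ C, ¬ G.Edge l k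

/-- The subgraph induced on `C` is structurally balanced; one of the two classes may be empty. -/
def StructurallyBalancedOn (C : Set (Fin N)) : Prop :=
  ∃ V₁ V₂ : Set (Fin N), V₁ ∩ V₂ = ∅ ∧ V₁ ∪ V₂ = C ∧
    (∀ k ∈ V₁, ∀ l ∈ V₁, 0 ≤ G.W k l) ∧ (∀ k ∈ V₂, ∀ l ∈ V₂, 0 ≤ G.W k l) ∧
    (∀ k ∈ V₁, ∀ l ∈ V₂, G.W k l ≤ 0) ∧ (∀ k ∈ V₂, ∀ l ∈ V₁, G.W k l ≤ 0)

/-- A leader is a node of some closed strong component; the other nodes are followers. -/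
def IsLeader (k : Fin N) : Prop := ∃ C, G.IsClosedStrongComponent C ∧ k ∈ C

/-- `max |x_k(t)|` over all leaders `k` (there is always at least one leader when `N ≥ 1`). -/
noncomputable def leaderMax (x : ℝ → Fin N → ℝ) (t : ℝ) : ℝ :=
  ⨆ k : {k : Fin N // G.IsLeader k}, |x t k|

end SignedDigraph

/-- The time scaling function `φ(t, T)` with exponent `κ`. -/
noncomputable def timeScaling (κ T t : ℝ) : ℝ :=
  if t < T then T ^ κ / (T - t) ^ κ else 1

/-- The derivative of `φ(t, T)` in `t` (the right-hand derivative at `t = T`). -/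
noncomputable def timeScalingDeriv (κ T t : ℝ) : ℝ :=
  if t < T then κ / T * timeScaling κ T t ^ (1 + 1 / κ) else 0

/-- The design parameters of the sliding-mode protocol, together with the bound `δ` of the
disturbances. -/
structure SlidingModeDesign where
  (κ ρ₁ ρ₂ μ₁ μ₂ μ₃ Tr Ts δ : ℝ)
  κ_pos : 0 < κ
  ρ₁_pos : 0 < ρ₁
  ρ₂_pos : 0 < ρ₂
  δ_pos : 0 < δ
  δ_lt_μ₁ : δ < μ₁
  μ₂_pos : 0 < μ₂
  μ₃_pos : 0 < μ₃
  Tr_pos : 0 < Tr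
  Ts_pos : 0 < Ts

/-- The Filippov set-valued sign: the closed convex hull of the limit values of `sign` at `r`. -/
def filippovSign (r : ℝ) : Set ℝ :=
  {s | (0 < r → s = 1) ∧ (r < 0 → s = -1) ∧ s ∈ Set.Icc (-1 : ℝ) 1}

namespace SlidingModeDesign

variable {N : ℕ} (P : SlidingModeDesign)

/-- The nominal control of agent `k` at time `t` in state `X`. -/
noncomputable def uNom (G : SignedDigraph N) (t : ℝ) (X : Fin N → ℝ) (k : Fin N) : ℝ :=
  (P.ρ₁ + P.ρ₂ * (timeScalingDeriv P.κ (P.Tr + P.Ts) t / timeScaling P.κ (P.Tr + P.Ts) t)) *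
    ∑ l, G.W k l * (X l - Real.sign (G.W k l) * X k)

/-- The disturbance-rejecting control at time `t`, for the value `σ` of the sliding variable and a
value `s` of its (set-valued) sign. -/
noncomputable def uDis (t σ s : ℝ) : ℝ :=
  -P.μ₁ * s - (P.μ₂ + P.μ₃ * (timeScalingDeriv P.κ P.Tr t / timeScaling P.κ P.Tr t)) * σ

/-- `(x, ς)` is a Filippov solution on `[0, ∞)` of the closed loop
`x_k' = u_k + d_k`, `ς_k' = -uNom_k`, `u_k = uDis_k + uNom_k`, `σ_k = x_k + ς_k`. The right-hand side
is discontinuous only through `sign σ_k`, so its Filippov regularization replaces that value by the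
set `filippovSign σ_k`, independently for each `k`. -/
structure IsClosedLoopSolution (G : SignedDigraph N) (d x ς : ℝ → Fin N → ℝ) : Prop where
  ac_x : ∀ k, ∀ b > 0, AbsolutelyContinuousOnInterval (fun t => x t k) 0 b
  ac_ς : ∀ k, ∀ b > 0, AbsolutelyContinuousOnInterval (fun t => ς t k) 0 b
  deriv_x : ∀ k, ∀ᵐ t, 0 < t → ∃ s ∈ filippovSign (x t k + ς t k),
    HasDerivAt (fun r => x r k) (P.uDis t (x t k + ς t k) s + P.uNom G t (x t) k + d t k) t
  deriv_ς : ∀ k, ∀ᵐ t, 0 < t → HasDerivAt (fun r => ς r k) (-P.uNom G t (x t) k) t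

end SlidingModeDesign

/-- The agents in `C` are stabilized within the time `T`. -/
def ReachesStabilityOn {N : ℕ} (C : Set (Fin N)) (x : ℝ → Fin N → ℝ) (T : ℝ) : Prop :=
  ∀ k ∈ C, Tendsto (fun t => x t k) (𝓝 T) (𝓝 0) ∧ ∀ t ≥ T, x t k = 0

/-- The agents in `C` reach bipartite consensus within the time `T`, with common modulus `c`. -/
def ReachesBipartiteConsensusOn {N : ℕ} (C : Set (Fin N)) (x : ℝ → Fin N → ℝ) (T c : ℝ) : Prop :=
  ∀ k ∈ C, Tendsto (fun t => |x t k|) (𝓝 T) (𝓝 c) ∧ ∀ t ≥ T, |x t k| = c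

/-- Bipartite containment within the time `T`. -/
structure ReachesBipartiteContainment {N : ℕ} (G : SignedDigraph N) (x : ℝ → Fin N → ℝ)
    (T : ℝ) : Prop where
  balanced : ∀ C, G.IsClosedStrongComponent C → G.StructurallyBalancedOn C →
    ∃ c ≥ 0, ReachesBipartiteConsensusOn C x T c
  unbalanced : ∀ C, G.IsClosedStrongComponent C → ¬ G.StructurallyBalancedOn C →
    ReachesStabilityOn C x T
  follower_limit : ∀ l, ¬ G.IsLeader l →
    ∃ c ≥ 0, Tendsto (fun t => G.leaderMax x t - |x t l|) (𝓝 T) (𝓝 c)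
  follower_mem : ∀ l, ¬ G.IsLeader l →
    ∀ t ≥ T, x t l ∈ Set.Icc (-G.leaderMax x t) (G.leaderMax x t)

/-!
The proof rests on three observations.

*Divergent gains.* Both gains dominate a multiple of `1 / (T - t)` before their terminal time `T`
(which is `Tr` for the first one), and the integral of this function diverges at `T`.
An absolutely continuous function is bounded, so its derivative cannot stay below `-c / (T - t)`
(`AbsolutelyContinuousOnInterval.false_of_ae_deriv_le`). Applied to `σₖ ^ 2`, which is nonincreasing
because the relay term dominates the disturbance, this gives `σ = 0` from `Tr` on
(`sliding_eq_zero`). From then on `x' = -g(t) L x` with the signed Laplacian `L`; if `(L x)ₖ` were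
nonzero at `T = Tr + Ts`, it would keep its sign shortly before, and the same principle applied to
`xₖ` gives a contradiction. Hence `x T` lies in the kernel of `L`
(`signedLaplacian_mulVec_eq_zero`), and `x` stays there since it solves `x' = -ρ₁ L x` afterwards
(`x_eq_terminal`). No explicit formula for the solutions is needed.

*Maximum principle.* For `X` in the kernel of `L`, a node whose modulus dominates that of its
in-neighbours shares it with them (`weight_mul_eq_of_abs_le`). So `|X|` is constant on each closed
strong component, it vanishes there if the component is unbalanced (otherwise the signs of `X` would
balance it), and, as every node has a closed strong component upstream, the overall maximum of `|X|`
is attained at a leader.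

*Conserved quantity.* On a balanced component `L` has a nonzero left null vector `ν` supported on
the component (`IsClosedStrongComponent.exists_vecMul_eq_zero`). Since `ς' = g(t) L x` from time `0`
on, `ν · ς` is constant (`sum_mul_ς_terminal`), and `x T = -ς T`; if `x T` vanishes on the
component, then `ν · ς 0 = 0`. The hyperplane orthogonal to `ν` is thus the exceptional subspace.
-/

/-! ### Absolutely continuous functions with one-sided derivative bounds -/

theorem AbsolutelyContinuousOnInterval.finset_sum {ι : Type*} (s : Finset ι) {f : ι → ℝ → ℝ}
    {a b : ℝ} (hf : ∀ i ∈ s, AbsolutelyContinuousOnInterval (f i) a b) :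
    AbsolutelyContinuousOnInterval (fun t => ∑ i ∈ s, f i t) a b := by
  classical
  induction s using Finset.induction_on with
  | empty =>
    simpa using (contDiff_const (c := (0 : ℝ))).contDiffOn.absolutelyContinuousOnInterval
  | insert i s hi ih =>
    simp only [Finset.sum_insert hi]
    exact (hf i (Finset.mem_insert_self i s)).fun_add
      (ih fun j hj => hf j (Finset.mem_insert_of_mem hj))

theorem AbsolutelyContinuousOnInterval.le_of_ae_hasDerivAt_nonpos {f : ℝ → ℝ} {a b : ℝ}
    (hab : a ≤ b) (hf : AbsolutelyContinuousOnInterval f a b)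
    (h : ∀ᵐ t, t ∈ Set.Ioo a b → ∃ f' ≤ 0, HasDerivAt f f' t) : f b ≤ f a := by
  have h_le : ∫ t in a..b, deriv f t ≤ 0 := by
    rw [intervalIntegral.integral_of_le hab, integral_Ioc_eq_integral_Ioo]
    refine setIntegral_nonpos_of_ae_restrict ?_
    filter_upwards [(ae_restrict_iff' measurableSet_Ioo).2 h] with t ⟨f', hf', hd⟩
    simpa [hd.deriv] using hf'
  rw [hf.integral_deriv_eq_sub] at h_le
  linarith

/-- The integral of `c / (T - t)` diverges at `T`, so a function that decreases at least at this
rate cannot stay bounded up to `T`. -/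
theorem AbsolutelyContinuousOnInterval.false_of_ae_deriv_le {f : ℝ → ℝ} {a T c : ℝ}
    (haT : a < T) (hc : 0 < c) (hf : AbsolutelyContinuousOnInterval f a T)
    (h : ∀ᵐ t, t ∈ Set.Ioo a T → ∃ f' ≤ -(c / (T - t)), HasDerivAt f f' t) : False := by
  obtain ⟨B, hB⟩ := hf.exists_bound
  have hB0 : 0 ≤ B := (norm_nonneg _).trans (hB a Set.left_mem_uIcc)
  -- At `b` the quantity `c * log (T - b)` is lower by `2 * B + 1` than at `a`.
  set M := (2 * B + 1) / c with hM
  have hM0 : 0 < M := by positivity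
  have hexp : Real.exp (-M) < 1 := by
    simpa using Real.exp_lt_exp.2 (neg_lt_zero.2 hM0)
  set b := T - (T - a) * Real.exp (-M) with hb
  have hTa : 0 < T - a := sub_pos.2 haT
  have hbT : b < T := by
    have := mul_pos hTa (Real.exp_pos (-M))
    linarith
  have hab : a < b := by nlinarith
  have hsub : Set.uIcc a b ⊆ Set.uIcc a T := by
    rw [Set.uIcc_of_le hab.le, Set.uIcc_of_le haT.le]
    exact Set.Icc_subset_Icc_right hbT.le
  have hlog : AbsolutelyContinuousOnInterval (fun t => c * Real.log (T - t)) a b := by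
    refine ContDiffOn.absolutelyContinuousOnInterval (contDiffOn_const.mul
      (ContDiffOn.log (contDiffOn_const.sub contDiffOn_id) fun t ht => ?_))
    rw [Set.uIcc_of_le hab.le] at ht
    exact (sub_pos.2 (ht.2.trans_lt hbT)).ne'
  have key := ((hf.mono hsub).fun_sub hlog).le_of_ae_hasDerivAt_nonpos hab.le (by
    filter_upwards [h] with t ht hmem
    obtain ⟨f', hf', hd⟩ := ht ⟨hmem.1, hmem.2.trans hbT⟩
    have hne : T - t ≠ 0 := (sub_pos.2 (hmem.2.trans hbT)).ne'
    refine ⟨_, ?_, hd.sub ((((hasDerivAt_id t).const_sub T).log hne).const_mul c)⟩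
    have : c * (-1 / (T - t)) = -(c / (T - t)) := by ring
    change f' - c * (-1 / (T - t)) ≤ 0
    linarith)
  have hlogb : Real.log (T - b) = Real.log (T - a) - M := by
    have : T - b = (T - a) * Real.exp (-M) := by rw [hb]; ring
    rw [this, Real.log_mul hTa.ne' (Real.exp_pos _).ne', Real.log_exp]
    ring
  have hcM : c * M = 2 * B + 1 := by rw [hM]; field_simp
  have h1 := abs_le.1 (hB a Set.left_mem_uIcc)
  have h2 := abs_le.1 (hB b (hsub Set.right_mem_uIcc))
  rw [hlogb] at key
  have : c * (Real.log (T - a) - M) = c * Real.log (T - a) - (2 * B + 1) := by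
    rw [mul_sub, hcM]
  linarith [h1.2, h2.1]

/-! ### The signed Laplacian and its kernel -/

namespace SignedDigraph

variable {N : ℕ} (G : SignedDigraph N)

/-- The signed Laplacian: row `k` has `∑ j, |W k j|` on the diagonal, and the negated weights
off it (the diagonal of `W` vanishes). Vectors in its kernel are called harmonic below. -/
noncomputable def signedLaplacian : Matrix (Fin N) (Fin N) ℝ :=
  Matrix.diagonal (fun k => ∑ j, |G.W k j|) - G.W

open Matrix in
theorem signedLaplacian_mulVec_apply (X : Fin N → ℝ) (k : Fin N) :
    (G.signedLaplacian *ᵥ X) k = ∑ l, (|G.W k l| * X k - G.W k l * X l) := by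
  rw [signedLaplacian, Matrix.sub_mulVec, Pi.sub_apply, Matrix.mulVec_diagonal,
    Finset.sum_sub_distrib, Finset.sum_mul]
  rfl

theorem signedLaplacian_apply_ne {k l : Fin N} (h : k ≠ l) :
    G.signedLaplacian k l = -G.W k l := by
  simp [signedLaplacian, Matrix.diagonal_apply_ne _ h]

variable {G}

open Matrix in
/-- Local maximum principle: at a node where `|X|` dominates its in-neighbours, harmonicity forces
equality along every incoming edge, up to the sign of the weight. -/
theorem weight_mul_eq_of_abs_le {X : Fin N → ℝ} {k : Fin N}
    (hk : (G.signedLaplacian *ᵥ X) k = 0) (hmax : ∀ l, G.Edge l k → |X l| ≤ |X k|) (l : Fin N) :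
    G.W k l * X l = |G.W k l| * X k := by
  by_cases hl : G.W k l = 0
  · simp [hl]
  by_cases hXk : X k = 0
  · have : X l = 0 := by simpa [hXk] using hmax l hl
    simp [this, hXk]
  rw [signedLaplacian_mulVec_apply] at hk
  have hnonneg : ∀ j ∈ Finset.univ, 0 ≤ X k * (|G.W k j| * X k - G.W k j * X j) := by
    intro j _
    by_cases hj : G.W k j = 0
    · simp [hj]
    have h1 : G.W k j * X j * X k ≤ |G.W k j| * (|X k| * |X k|) := by
      calc G.W k j * X j * X k ≤ |G.W k j * X j * X k| := le_abs_self _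
        _ = |G.W k j| * (|X j| * |X k|) := by rw [abs_mul, abs_mul, mul_assoc]
        _ ≤ _ := mul_le_mul_of_nonneg_left
            (mul_le_mul_of_nonneg_right (hmax j hj) (abs_nonneg _)) (abs_nonneg _)
    rw [abs_mul_abs_self] at h1
    linarith
  have hsum : ∑ j, X k * (|G.W k j| * X k - G.W k j * X j) = 0 := by
    rw [← Finset.mul_sum, hk, mul_zero]
  have h0 := (Finset.sum_eq_zero_iff_of_nonneg hnonneg).1 hsum l (Finset.mem_univ l)
  rcases mul_eq_zero.1 h0 with h0 | h0
  · exact absurd h0 hXk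
  · linarith

open Matrix in
theorem abs_eq_of_edge {X : Fin N → ℝ} {k l : Fin N}
    (hk : (G.signedLaplacian *ᵥ X) k = 0) (hmax : ∀ j, G.Edge j k → |X j| ≤ |X k|)
    (hl : G.Edge l k) : |X l| = |X k| := by
  have h := congrArg abs (weight_mul_eq_of_abs_le hk hmax l)
  rw [abs_mul, abs_mul, abs_abs] at h
  exact mul_left_cancel₀ (abs_ne_zero.2 hl) h

open Matrix in
theorem IsClosedStrongComponent.abs_eq {C : Set (Fin N)} (hC : G.IsClosedStrongComponent C)
    {X : Fin N → ℝ} (hX : ∀ k ∈ C, (G.signedLaplacian *ᵥ X) k = 0) {a b : Fin N} (ha : a ∈ C)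
    (hb : b ∈ C) : |X a| = |X b| := by
  obtain ⟨k, hkC, hk⟩ := C.toFinite.exists_maximalFor (fun j => |X j|) C hC.1.prop.1
  have hmax : ∀ j ∈ C, |X j| ≤ |X k| := fun j hj =>
    (le_total |X j| |X k|).elim id fun h => hk hj h
  have hedge : ∀ {j i}, i ∈ C → G.Edge j i → j ∈ C := fun {j i} hi hj => by
    by_contra hjC
    exact hC.2 i hi j hjC hj
  suffices h : ∀ a ∈ C, |X a| = |X k| from (h a ha).trans (h b hb).symm
  intro a ha
  induction hC.1.prop.2 a ha k hkC using Relation.ReflTransGen.head_induction_on with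
  | refl => rfl
  | head h _ ih =>
    obtain ⟨_, hc, he⟩ := h
    have hc' := ih hc
    exact (abs_eq_of_edge (hX _ hc) (fun j hj => hc' ▸ hmax j (hedge hc hj)) he).trans hc'

open Matrix in
/-- A nonvanishing harmonic vector splits a closed strong component by its sign, so on an
unbalanced component every harmonic vector vanishes. -/
theorem IsClosedStrongComponent.eq_zero_of_unbalanced {C : Set (Fin N)}
    (hC : G.IsClosedStrongComponent C) (hub : ¬ G.StructurallyBalancedOn C) {X : Fin N → ℝ}
    (hX : ∀ k ∈ C, (G.signedLaplacian *ᵥ X) k = 0) {a : Fin N} (ha : a ∈ C) : X a = 0 := by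
  by_contra ha0
  apply hub
  have hne : ∀ k ∈ C, X k ≠ 0 := fun k hk => by
    rw [← abs_ne_zero, hC.abs_eq hX hk ha]
    exact abs_ne_zero.2 ha0
  have hW : ∀ k ∈ C, ∀ l, G.W k l * X l = |G.W k l| * X k := fun k hk =>
    weight_mul_eq_of_abs_le (hX k hk) fun j hj =>
      (hC.abs_eq hX (by_contra fun hjC => hC.2 k hk j hjC hj) hk).le
  refine ⟨{k ∈ C | 0 < X k}, {k ∈ C | X k < 0}, ?_, ?_, ?_, ?_, ?_, ?_⟩
  · ext k
    simp only [Set.mem_inter_iff, Set.mem_ofPred_eq, Set.mem_empty_iff_false, iff_false]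
    rintro ⟨⟨_, h1⟩, _, h2⟩
    exact lt_asymm h1 h2
  · ext k
    simp only [Set.mem_union, Set.mem_ofPred_eq, ← and_or_left]
    exact ⟨fun h => h.1, fun h => ⟨h, (hne k h).lt_or_gt.symm⟩⟩
  all_goals
    rintro k ⟨hk, hXk⟩ l ⟨_, hXl⟩
    have h := hW k hk l
    by_contra! hlt
    -- A weight of the wrong sign turns `h` into `W k l * (X l + X k) = 0` for nodes of one class,
    -- and into `W k l * (X l - X k) = 0` for nodes of different classes.
    first
      | rw [abs_of_neg hlt] at h; nlinarith
      | rw [abs_of_pos hlt] at h; nlinarith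

/-- Every node has a closed strong component upstream: the ancestors of an ancestor that has as
few ancestors as possible. -/
theorem exists_isClosedStrongComponent_upstream (k : Fin N) :
    ∃ C, G.IsClosedStrongComponent C ∧ ∀ b ∈ C, Relation.ReflTransGen G.Edge b k := by
  let A : Fin N → Set (Fin N) := fun j => {a | Relation.ReflTransGen G.Edge a j}
  obtain ⟨b, hbk, hb⟩ := (A k).toFinite.exists_minimalFor (fun j => (A j).ncard) (A k)
    ⟨k, Relation.ReflTransGen.refl⟩
  have hmono : ∀ {a}, a ∈ A b → A a ⊆ A b := fun ha c hc => Relation.ReflTransGen.trans hc ha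
  have hback : ∀ a ∈ A b, Relation.ReflTransGen G.Edge b a := fun a ha => by
    have hle := hb (Relation.ReflTransGen.trans ha hbk) (Set.ncard_le_ncard (hmono ha))
    have heq : A a = A b := Set.eq_of_subset_of_ncard_le (hmono ha) hle
    have : b ∈ A a := heq ▸ (Relation.ReflTransGen.refl : Relation.ReflTransGen G.Edge b b)
    exact this
  refine ⟨A b, ⟨⟨⟨⟨b, Relation.ReflTransGen.refl⟩, fun u hu v hv => ?_⟩, ?_⟩, ?_⟩,
    fun c hc => Relation.ReflTransGen.trans hc hbk⟩
  · have huv : Relation.ReflTransGen G.Edge u v := Relation.ReflTransGen.trans hu (hback v hv)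
    induction huv using Relation.ReflTransGen.head_induction_on with
    | refl => exact Relation.ReflTransGen.refl
    | head h h' ih =>
      have hc := Relation.ReflTransGen.trans h' hv
      exact (ih hc).head ⟨hu, hc, h⟩
  · intro C' hC' hsub c hc
    have hcb := hC'.2 c hc b (hsub Relation.ReflTransGen.refl)
    exact Relation.ReflTransGen.mono (fun _ _ h => h.2.2) _ _ hcb
  · intro i hi l hl he
    exact hl (Relation.ReflTransGen.head he hi)

open Matrix in
/-- Maximum principle: a harmonic vector attains its largest modulus at a leader. -/
theorem exists_isLeader_forall_abs_le [NeZero N] {X : Fin N → ℝ}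
    (hX : G.signedLaplacian *ᵥ X = 0) : ∃ b, G.IsLeader b ∧ ∀ l, |X l| ≤ |X b| := by
  obtain ⟨k, hk⟩ := Finite.exists_max fun j => |X j|
  obtain ⟨C, hC, hup⟩ := exists_isClosedStrongComponent_upstream (G := G) k
  obtain ⟨b, hb⟩ := hC.1.prop.1
  refine ⟨b, ⟨C, hC, hb⟩, ?_⟩
  have : |X b| = |X k| := by
    have hbk := hup b hb
    clear hup hb
    induction hbk using Relation.ReflTransGen.head_induction_on with
    | refl => rfl
    | head h _ ih => exact (abs_eq_of_edge (congrFun hX _) (fun j _ => ih ▸ hk j) h).trans ih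
  exact this ▸ hk

open Matrix in
/-- On a balanced closed strong component the signed Laplacian has a nontrivial right kernel (the
signs of the two classes), hence a nontrivial left kernel; since no edge enters the component, a
left null vector extends by zero. -/
theorem IsClosedStrongComponent.exists_vecMul_eq_zero {C : Set (Fin N)}
    (hC : G.IsClosedStrongComponent C) (hbal : G.StructurallyBalancedOn C) :
    ∃ ν : Fin N → ℝ, ν ≠ 0 ∧ (∀ k ∉ C, ν k = 0) ∧ ν ᵥ* G.signedLaplacian = 0 := by
  classical
  obtain ⟨V₁, V₂, hdisj, hunion, h11, h22, h12, h21⟩ := hbal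
  have hcol : ∀ k ∈ C, ∀ l ∉ C, G.W k l = 0 := fun k hk l hl => not_not.1 (hC.2 k hk l hl)
  have hV : ∀ k, k ∈ C ↔ k ∈ V₁ ∨ k ∈ V₂ := fun k => by rw [← hunion]; rfl
  have hV12 : ∀ k ∈ V₁, k ∉ V₂ := fun k h1 h2 => by
    have : k ∈ V₁ ∩ V₂ := ⟨h1, h2⟩
    simp [hdisj] at this
  -- The rows outside `C` are replaced by those of the identity.
  let M : Matrix (Fin N) (Fin N) ℝ := fun k l =>
    if k ∈ C then G.signedLaplacian k l else (1 : Matrix (Fin N) (Fin N) ℝ) k l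
  let v : Fin N → ℝ := fun k => if k ∈ V₁ then 1 else if k ∈ V₂ then -1 else 0
  have hv : v ≠ 0 := by
    obtain ⟨a, ha⟩ := hC.1.prop.1
    intro h0
    have := congrFun h0 a
    by_cases ha1 : a ∈ V₁
    · simp [v, ha1] at this
    · have ha2 : a ∈ V₂ := ((hV a).1 ha).resolve_left ha1
      simp [v, ha1, ha2] at this
  have hMv : M *ᵥ v = 0 := by
    ext k
    by_cases hk : k ∈ C
    · have : (M *ᵥ v) k = (G.signedLaplacian *ᵥ v) k := by
        simp [Matrix.mulVec, dotProduct, M, hk]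
      rw [this, signedLaplacian_mulVec_apply]
      refine Finset.sum_eq_zero fun l _ => ?_
      by_cases hl : l ∈ C
      · rcases (hV k).1 hk with hk | hk <;> rcases (hV l).1 hl with hl | hl
        · simp [v, hk, hl, abs_of_nonneg (h11 k hk l hl)]
        · have hl' : l ∉ V₁ := fun h => hV12 l h hl
          simp [v, hk, hl, hl', abs_of_nonpos (h12 k hk l hl)]
        · have hk' : k ∉ V₁ := fun h => hV12 k h hk
          simp [v, hk, hl, hk', abs_of_nonpos (h21 k hk l hl)]
        · have hl' : l ∉ V₁ := fun h => hV12 l h hl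
          have hk' : k ∉ V₁ := fun h => hV12 k h hk
          simp [v, hk, hl, hk', hl', abs_of_nonneg (h22 k hk l hl)]
      · simp [hcol k hk l hl]
    · have hk' : k ∉ V₁ ∧ k ∉ V₂ := not_or.1 fun h => hk ((hV k).2 h)
      have : (M *ᵥ v) k = ((1 : Matrix (Fin N) (Fin N) ℝ) *ᵥ v) k := by
        simp only [Matrix.mulVec, dotProduct, M, if_neg hk]
      rw [this, Matrix.one_mulVec]
      simp [v, hk'.1, hk'.2]
  obtain ⟨ν, hν, hνM⟩ := Matrix.exists_vecMul_eq_zero_iff.2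
    (Matrix.exists_mulVec_eq_zero_iff.1 ⟨v, hv, hMv⟩)
  have hoff : ∀ k ∉ C, ν k = 0 := fun k hk => by
    have h := congrFun hνM k
    rw [Matrix.vecMul, dotProduct, Finset.sum_eq_single k] at h
    · simpa [M, hk] using h
    · intro i _ hik
      by_cases hi : i ∈ C
      · simp [M, hi, signedLaplacian_apply_ne G hik, hcol i hi k hk]
      · simp [M, hi, Matrix.one_apply_ne hik]
    · simp
  refine ⟨ν, hν, hoff, ?_⟩
  rw [← hνM]
  ext j
  simp only [Matrix.vecMul, dotProduct]
  refine Finset.sum_congr rfl fun i _ => ?_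
  by_cases hi : i ∈ C
  · simp [M, hi]
  · simp [hoff i hi]

theorem abs_le_leaderMax (x : ℝ → Fin N → ℝ) (t : ℝ) {k : Fin N} (hk : G.IsLeader k) :
    |x t k| ≤ G.leaderMax x t :=
  le_ciSup (f := fun k : {k : Fin N // G.IsLeader k} => |x t k|)
    (Set.finite_range _).bddAbove ⟨k, hk⟩

theorem continuousAt_leaderMax [NeZero N] {x : ℝ → Fin N → ℝ} {t : ℝ}
    (hx : ∀ k, ContinuousAt (fun r => x r k) t) : ContinuousAt (G.leaderMax x) t := by
  classical
  obtain ⟨C, hC, _⟩ := exists_isClosedStrongComponent_upstream (G := G) (0 : Fin N)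
  obtain ⟨b, hb⟩ := hC.1.prop.1
  have : Nonempty {k : Fin N // G.IsLeader k} := ⟨⟨b, C, hC, hb⟩⟩
  have heq : G.leaderMax x = fun r => Finset.univ.sup' Finset.univ_nonempty
      fun k : {k : Fin N // G.IsLeader k} => |x r k| := by
    funext r
    rw [Finset.sup'_univ_eq_ciSup]
    rfl
  rw [heq]
  exact ContinuousAt.finset_sup'_apply _ fun k _ => (hx k).abs

end SignedDigraph

/-! ### The closed loop -/

theorem timeScalingDeriv_div_timeScaling_of_lt {κ T t : ℝ} (hκ : 0 < κ) (hT : 0 < T)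
    (ht : t < T) : timeScalingDeriv κ T t / timeScaling κ T t = κ / (T - t) := by
  have hTt : 0 < T - t := sub_pos.2 ht
  have hq : 0 < T / (T - t) := div_pos hT hTt
  have hφ : timeScaling κ T t = (T / (T - t)) ^ κ := by
    rw [timeScaling, if_pos ht, Real.div_rpow hT.le hTt.le]
  have hpos : 0 < (T / (T - t)) ^ κ := Real.rpow_pos_of_pos hq κ
  rw [timeScalingDeriv, if_pos ht, hφ, Real.rpow_add hpos, Real.rpow_one, ← Real.rpow_mul hq.le,
    mul_one_div_cancel hκ.ne', Real.rpow_one]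
  field_simp

theorem timeScalingDeriv_div_timeScaling_of_le {κ T t : ℝ} (ht : T ≤ t) :
    timeScalingDeriv κ T t / timeScaling κ T t = 0 := by
  simp [timeScalingDeriv, not_lt.2 ht]

namespace SlidingModeDesign

variable {N : ℕ} {P : SlidingModeDesign} {G : SignedDigraph N} {d x ς : ℝ → Fin N → ℝ}

open Matrix in
theorem uNom_eq (t : ℝ) (X : Fin N → ℝ) (k : Fin N) :
    P.uNom G t X k = -(P.ρ₁ + P.ρ₂ * (timeScalingDeriv P.κ (P.Tr + P.Ts) t /
      timeScaling P.κ (P.Tr + P.Ts) t)) * (G.signedLaplacian *ᵥ X) k := by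
  rw [uNom, G.signedLaplacian_mulVec_apply, neg_mul, ← mul_neg, ← Finset.sum_neg_distrib]
  congr 1
  refine Finset.sum_congr rfl fun l _ => ?_
  have h : G.W k l * Real.sign (G.W k l) = |G.W k l| := by
    rcases lt_trichotomy (G.W k l) 0 with h | h | h
    · rw [Real.sign_of_neg h, abs_of_neg h, mul_neg_one]
    · simp [h]
    · rw [Real.sign_of_pos h, abs_of_pos h, mul_one]
  rw [← h]
  ring

theorem mul_eq_abs_of_mem_filippovSign {r s : ℝ} (hs : s ∈ filippovSign r) : s * r = |r| := by
  rcases lt_trichotomy r 0 with h | h | h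
  · rw [hs.2.1 h, abs_of_neg h, neg_one_mul]
  · simp [h]
  · rw [hs.1 h, abs_of_pos h, one_mul]

namespace IsClosedLoopSolution

variable (h : P.IsClosedLoopSolution G d x ς)
include h

theorem continuousAt_x (k : Fin N) {t : ℝ} (ht : 0 < t) : ContinuousAt (fun r => x r k) t := by
  refine (h.ac_x k (t + 1) (by linarith)).continuousOn.continuousAt ?_
  rw [Set.uIcc_of_le (by linarith)]
  exact Icc_mem_nhds ht (by linarith)

theorem ac_x_of_nonneg (k : Fin N) {a b : ℝ} (ha : 0 ≤ a) (hb : 0 < b) :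
    AbsolutelyContinuousOnInterval (fun t => x t k) a b := by
  refine (h.ac_x k (max a b) (lt_max_of_lt_right hb)).mono (Set.uIcc_subset_uIcc ?_ ?_) <;>
  rw [Set.uIcc_of_le (le_max_of_le_left ha)]
  · exact ⟨ha, le_max_left _ _⟩
  · exact ⟨hb.le, le_max_right _ _⟩

theorem ac_ς_of_nonneg (k : Fin N) {a b : ℝ} (ha : 0 ≤ a) (hb : 0 < b) :
    AbsolutelyContinuousOnInterval (fun t => ς t k) a b := by
  refine (h.ac_ς k (max a b) (lt_max_of_lt_right hb)).mono (Set.uIcc_subset_uIcc ?_ ?_) <;>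
  rw [Set.uIcc_of_le (le_max_of_le_left ha)]
  · exact ⟨ha, le_max_left _ _⟩
  · exact ⟨hb.le, le_max_right _ _⟩

/-- The square of the sliding variable decays along a solution: the relay term `μ₁ * sign σ`
dominates the disturbance. -/
theorem ae_hasDerivAt_sq_sliding (hd : ∀ k, ∀ t ≥ 0, |d t k| ≤ P.δ) (k : Fin N) :
    ∀ᵐ t, 0 < t → ∃ f' ≤ -(2 * (P.μ₂ + P.μ₃ * (timeScalingDeriv P.κ P.Tr t /
      timeScaling P.κ P.Tr t)) * ((x t k + ς t k) * (x t k + ς t k))),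
      HasDerivAt (fun r => (x r k + ς r k) * (x r k + ς r k)) f' t := by
  filter_upwards [h.deriv_x k, h.deriv_ς k] with t hx hς ht
  obtain ⟨s, hs, hx⟩ := hx ht
  have hσ := hx.add (hς ht)
  refine ⟨_, ?_, hσ.mul hσ⟩
  have h1 := mul_eq_abs_of_mem_filippovSign hs
  have h2 : d t k * (x t k + ς t k) ≤ P.δ * |x t k + ς t k| :=
    (le_abs_self _).trans ((abs_mul _ _).trans_le
      (mul_le_mul_of_nonneg_right (hd k t ht.le) (abs_nonneg _)))
  have h3 := mul_le_mul_of_nonneg_right P.δ_lt_μ₁.le (abs_nonneg (x t k + ς t k))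
  simp only [uDis, Pi.add_apply]
  rw [← h1] at h2 h3
  nlinarith

theorem ac_sq_sliding (k : Fin N) {a b : ℝ} (ha : 0 ≤ a) (hb : 0 < b) :
    AbsolutelyContinuousOnInterval (fun r => (x r k + ς r k) * (x r k + ς r k)) a b :=
  have hσ := (h.ac_x_of_nonneg k ha hb).fun_add (h.ac_ς_of_nonneg k ha hb)
  hσ.fun_mul hσ

theorem sq_sliding_antitone (hd : ∀ k, ∀ t ≥ 0, |d t k| ≤ P.δ) (k : Fin N) {a b : ℝ}
    (ha : 0 ≤ a) (hb : 0 < b) (hab : a ≤ b) :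
    (x b k + ς b k) * (x b k + ς b k) ≤ (x a k + ς a k) * (x a k + ς a k) := by
  refine (h.ac_sq_sliding k ha hb).le_of_ae_hasDerivAt_nonpos hab ?_
  filter_upwards [h.ae_hasDerivAt_sq_sliding hd k] with t ht hmem
  obtain ⟨f', hf', hderiv⟩ := ht (ha.trans_lt hmem.1)
  refine ⟨f', hf'.trans (neg_nonpos.2 (mul_nonneg (mul_nonneg zero_le_two (add_nonneg P.μ₂_pos.le
    (mul_nonneg P.μ₃_pos.le ?_))) (mul_self_nonneg _))), hderiv⟩
  rcases lt_or_ge t P.Tr with htr | htr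
  · rw [timeScalingDeriv_div_timeScaling_of_lt P.κ_pos P.Tr_pos htr]
    exact div_nonneg P.κ_pos.le (sub_pos.2 htr).le
  · rw [timeScalingDeriv_div_timeScaling_of_le htr]

/-- The sliding surface is reached by the time `Tr`: otherwise `σ ^ 2` would stay above a positive
value on `[0, Tr]` and hence decrease at a rate with divergent integral. -/
theorem sliding_eq_zero (hd : ∀ k, ∀ t ≥ 0, |d t k| ≤ P.δ) (k : Fin N) {t : ℝ} (ht : P.Tr ≤ t) :
    x t k = -ς t k := by
  have hTr := P.Tr_pos
  suffices h0 : (x P.Tr k + ς P.Tr k) * (x P.Tr k + ς P.Tr k) ≤ 0 by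
    have := (h.sq_sliding_antitone hd k hTr.le (hTr.trans_le ht) ht).trans h0
    have := mul_self_eq_zero.1 (this.antisymm (mul_self_nonneg _))
    linarith
  by_contra! hpos
  set v := (x P.Tr k + ς P.Tr k) * (x P.Tr k + ς P.Tr k)
  have hc : 0 < 2 * P.μ₃ * P.κ * v :=
    mul_pos (mul_pos (mul_pos two_pos P.μ₃_pos) P.κ_pos) hpos
  refine (h.ac_sq_sliding k le_rfl hTr).false_of_ae_deriv_le hTr hc ?_
  filter_upwards [h.ae_hasDerivAt_sq_sliding hd k] with s hs hmem
  obtain ⟨f', hf', hderiv⟩ := hs hmem.1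
  refine ⟨f', hf'.trans (neg_le_neg ?_), hderiv⟩
  rw [timeScalingDeriv_div_timeScaling_of_lt P.κ_pos hTr hmem.2]
  have hv : v ≤ (x s k + ς s k) * (x s k + ς s k) :=
    h.sq_sliding_antitone hd k hmem.1.le hTr hmem.2.le
  have hr : 0 ≤ P.κ / (P.Tr - s) := div_nonneg P.κ_pos.le (sub_pos.2 hmem.2).le
  have hμ₂ := P.μ₂_pos
  have hμ₃ := P.μ₃_pos
  calc 2 * P.μ₃ * P.κ * v / (P.Tr - s) = 2 * (P.μ₃ * (P.κ / (P.Tr - s))) * v := by ring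
    _ ≤ _ := by gcongr; linarith

/-- On the sliding surface the disturbance is cancelled and `x` follows the nominal dynamics. -/
theorem ae_hasDerivAt_x (hd : ∀ k, ∀ t ≥ 0, |d t k| ≤ P.δ) (k : Fin N) :
    ∀ᵐ t, P.Tr < t → HasDerivAt (fun r => x r k) (P.uNom G t (x t) k) t := by
  filter_upwards [h.deriv_ς k] with t hς ht
  have := (hς (P.Tr_pos.trans ht)).neg
  rw [neg_neg] at this
  refine this.congr_of_eventuallyEq ?_
  filter_upwards [Ioi_mem_nhds ht] with r hr
  exact h.sliding_eq_zero hd k (le_of_lt hr)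

open Matrix in
/-- At the terminal time the state is harmonic: if `(L x)ₖ` did not vanish there, it would keep its
sign shortly before, where the gain has a divergent integral, although `xₖ` stays bounded. -/
theorem signedLaplacian_mulVec_eq_zero (hd : ∀ k, ∀ t ≥ 0, |d t k| ≤ P.δ) :
    G.signedLaplacian *ᵥ x (P.Tr + P.Ts) = 0 := by
  have hTr := P.Tr_pos
  have hTs := P.Ts_pos
  set T := P.Tr + P.Ts with hT
  have hT0 : 0 < T := by positivity
  ext k
  by_contra hq
  change (G.signedLaplacian *ᵥ x T) k ≠ 0 at hq
  set q := (G.signedLaplacian *ᵥ x T) k with hqdef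
  have hcont : ContinuousAt (fun t => q * (G.signedLaplacian *ᵥ x t) k) T := by
    refine continuousAt_const.mul ?_
    simp only [Matrix.mulVec, dotProduct]
    exact tendsto_finsetSum _ fun l _ => (h.continuousAt_x l hT0).const_mul _
  have hq2 : 0 < q * q := mul_self_pos.2 hq
  have hev := hcont.eventually_const_lt (show q * q / 2 < q * q by linarith)
  obtain ⟨ε, hε, hball⟩ := Metric.eventually_nhds_iff.1 hev
  obtain ⟨a, ha1, ha2⟩ := exists_between (show max P.Tr (T - ε) < T from
    max_lt (by linarith) (by linarith))
  have haTr : P.Tr < a := (le_max_left _ _).trans_lt ha1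
  have haε : T - ε < a := (le_max_right _ _).trans_lt ha1
  have hac := (h.ac_x_of_nonneg k (hTr.trans haTr).le hT0).const_mul q
  have hκ := P.κ_pos
  have hρ₁ := P.ρ₁_pos
  have hρ₂ := P.ρ₂_pos
  refine hac.false_of_ae_deriv_le ha2 (show 0 < P.ρ₂ * P.κ * (q * q / 2) by positivity) ?_
  filter_upwards [h.ae_hasDerivAt_x hd k] with t ht hmem
  refine ⟨_, ?_, (ht (haTr.trans hmem.1)).const_mul q⟩
  have hTt : 0 < T - t := sub_pos.2 hmem.2
  have hlow : q * q / 2 < q * (G.signedLaplacian *ᵥ x t) k := hball (by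
    rw [Real.dist_eq, abs_lt]
    constructor <;> linarith [hmem.1, hmem.2])
  rw [uNom_eq, ← hT, timeScalingDeriv_div_timeScaling_of_lt hκ hT0 hmem.2]
  calc q * (-(P.ρ₁ + P.ρ₂ * (P.κ / (T - t))) * (G.signedLaplacian *ᵥ x t) k)
      = -((P.ρ₁ + P.ρ₂ * (P.κ / (T - t))) * (q * (G.signedLaplacian *ᵥ x t) k)) := by ring
    _ ≤ -(P.ρ₂ * (P.κ / (T - t)) * (q * q / 2)) := by
      gcongr
      linarith
    _ = _ := by ring

open Matrix in
/-- After the terminal time `x` solves the autonomous linear equation `x' = -ρ₁ L x` from a zero of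
`L`, so it stays put; uniqueness is a Grönwall estimate for the squared distance. -/
theorem x_eq_terminal (hd : ∀ k, ∀ t ≥ 0, |d t k| ≤ P.δ) {t : ℝ} (ht : P.Tr + P.Ts ≤ t) :
    x t = x (P.Tr + P.Ts) := by
  have hTr := P.Tr_pos
  have hTs := P.Ts_pos
  have hρ₁ := P.ρ₁_pos
  have hker := h.signedLaplacian_mulVec_eq_zero hd
  set T := P.Tr + P.Ts with hT
  have hT0 : 0 < T := by positivity
  set A := G.signedLaplacian
  set K := 2 * P.ρ₁ * ∑ k, ∑ l, |A k l| with hK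
  let S : (Fin N → ℝ) → ℝ := fun y => ∑ k, y k * y k
  have hle : ∀ y : Fin N → ℝ, ∀ k, y k * y k ≤ S y := fun y k =>
    Finset.single_le_sum (f := fun k => y k * y k) (fun _ _ => mul_self_nonneg _)
      (Finset.mem_univ k)
  have hbound : ∀ y : Fin N → ℝ, ∑ k, 2 * (y k * (-P.ρ₁ * (A *ᵥ y) k)) ≤ K * S y := by
    intro y
    have hterm : ∀ k l, -(A k l * (y k * y l)) ≤ |A k l| * S y := fun k l =>
      calc -(A k l * (y k * y l)) ≤ |A k l * (y k * y l)| := neg_le_abs _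
        _ = |A k l| * |y k * y l| := abs_mul _ _
        _ ≤ _ := by
          refine mul_le_mul_of_nonneg_left (abs_le.2 ?_) (abs_nonneg _)
          have h1 := hle y k
          have h2 := hle y l
          constructor <;> nlinarith [mul_self_nonneg (y k + y l), mul_self_nonneg (y k - y l)]
    calc ∑ k, 2 * (y k * (-P.ρ₁ * (A *ᵥ y) k))
        = 2 * P.ρ₁ * ∑ k, ∑ l, -(A k l * (y k * y l)) := by
          rw [Finset.mul_sum]
          refine Finset.sum_congr rfl fun k _ => ?_
          rw [Finset.sum_neg_distrib]
          simp only [Matrix.mulVec, dotProduct, Finset.mul_sum, ← Finset.sum_neg_distrib]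
          exact Finset.sum_congr rfl fun l _ => by ring
      _ ≤ 2 * P.ρ₁ * ∑ k, ∑ l, |A k l| * S y := by
          gcongr with k _ l _
          exact hterm k l
      _ = K * S y := by simp only [hK, ← Finset.sum_mul, mul_assoc]
  have hacS : AbsolutelyContinuousOnInterval (fun r => S (fun k => x r k - x T k)) T t := by
    refine AbsolutelyContinuousOnInterval.finset_sum _ fun k _ => ?_
    have hy : AbsolutelyContinuousOnInterval (fun r => x r k - x T k) T t :=
      (h.ac_x_of_nonneg k hT0.le (hT0.trans_le ht)).fun_sub
        (contDiff_const (c := x T k)).contDiffOn.absolutelyContinuousOnInterval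
    exact hy.fun_mul hy
  have hexp : AbsolutelyContinuousOnInterval (fun r => Real.exp (-K * r)) T t :=
    (Real.contDiff_exp.comp (contDiff_const.mul contDiff_id)).contDiffOn
      |>.absolutelyContinuousOnInterval
  have hderiv : ∀ᵐ r, ∀ k, P.Tr < r → HasDerivAt (fun r => x r k) (P.uNom G r (x r) k) r :=
    ae_all_iff.2 fun k => h.ae_hasDerivAt_x hd k
  have key := (hexp.fun_mul hacS).le_of_ae_hasDerivAt_nonpos ht (by
    filter_upwards [hderiv] with r hr hmem
    have hy : ∀ k, HasDerivAt (fun r => x r k - x T k)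
        (-P.ρ₁ * (A *ᵥ fun k => x r k - x T k) k) r := fun k => by
      have h1 := (hr k (by linarith [hmem.1])).sub_const (x T k)
      rw [uNom_eq, ← hT, timeScalingDeriv_div_timeScaling_of_le hmem.1.le, mul_zero, add_zero] at h1
      have h2 : (A *ᵥ fun k => x r k - x T k) = A *ᵥ x r := by
        change A *ᵥ (x r - x T) = _
        rw [Matrix.mulVec_sub, hker, sub_zero]
      rwa [h2]
    have hS : HasDerivAt (fun r => S (fun k => x r k - x T k))
        (∑ k, 2 * ((x r k - x T k) * (-P.ρ₁ * (A *ᵥ fun k => x r k - x T k) k))) r := by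
      refine (HasDerivAt.fun_sum (u := Finset.univ) fun k _ => (hy k).mul (hy k)).congr_deriv ?_
      exact Finset.sum_congr rfl fun k _ => by ring
    have hE : HasDerivAt (fun r => Real.exp (-K * r)) (Real.exp (-K * r) * (-K)) r := by
      simpa using ((hasDerivAt_id r).const_mul (-K)).exp
    refine ⟨_, ?_, hE.mul hS⟩
    have hb := mul_le_mul_of_nonneg_left (hbound fun k => x r k - x T k)
      (Real.exp_pos (-K * r)).le
    linarith)
  have hST : S (fun k => x T k - x T k) = 0 := by simp [S]
  rw [hST, mul_zero] at key
  have hSt : S (fun k => x t k - x T k) ≤ 0 := nonpos_of_mul_nonpos_right key (Real.exp_pos _)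
  ext k
  have h0 := ((hle (fun k => x t k - x T k) k).trans hSt).antisymm (mul_self_nonneg _)
  exact sub_eq_zero.1 (mul_self_eq_zero.1 h0)

open Matrix in
/-- A left null vector of the signed Laplacian gives a conserved quantity of the auxiliary state,
through the reaching phase as well. -/
theorem sum_mul_ς_terminal {ν : Fin N → ℝ} (hν : ν ᵥ* G.signedLaplacian = 0) :
    ∑ k, ν k * ς (P.Tr + P.Ts) k = ∑ k, ν k * ς 0 k := by
  have hT0 : 0 < P.Tr + P.Ts := add_pos P.Tr_pos P.Ts_pos
  have hac : AbsolutelyContinuousOnInterval (fun t => ∑ k, ν k * ς t k) 0 (P.Tr + P.Ts) :=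
    AbsolutelyContinuousOnInterval.finset_sum _ fun k _ =>
      (h.ac_ς k _ hT0).const_mul (ν k)
  obtain ⟨c, hc⟩ := hac.const_of_ae_hasDerivAt_zero (by
    filter_upwards [ae_all_iff.2 h.deriv_ς, Measure.ae_ne volume 0] with t ht ht0 hmem
    rw [Set.uIcc_of_le hT0.le] at hmem
    have htpos : 0 < t := lt_of_le_of_ne hmem.1 ht0.symm
    refine (HasDerivAt.fun_sum (u := Finset.univ) fun k _ =>
      (ht k htpos).const_mul (ν k)).congr_deriv ?_
    set g := P.ρ₁ + P.ρ₂ * (timeScalingDeriv P.κ (P.Tr + P.Ts) t /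
      timeScaling P.κ (P.Tr + P.Ts) t) with hg
    calc ∑ k, ν k * -P.uNom G t (x t) k = g * (ν ⬝ᵥ (G.signedLaplacian *ᵥ x t)) := by
          rw [dotProduct, Finset.mul_sum]
          refine Finset.sum_congr rfl fun k _ => ?_
          rw [uNom_eq, ← hg]
          ring
      _ = 0 := by rw [Matrix.dotProduct_mulVec, hν, zero_dotProduct, mul_zero])
  exact (hc _ Set.right_mem_uIcc).trans (hc _ Set.left_mem_uIcc).symm

theorem reachesBipartiteConsensusOn (hd : ∀ k, ∀ t ≥ 0, |d t k| ≤ P.δ) {C : Set (Fin N)} {c : ℝ}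
    (hc : ∀ k ∈ C, |x (P.Tr + P.Ts) k| = c) :
    ReachesBipartiteConsensusOn C x (P.Tr + P.Ts) c := by
  intro k hk
  refine ⟨?_, fun t ht => by rw [h.x_eq_terminal hd ht, hc k hk]⟩
  rw [← hc k hk]
  exact (h.continuousAt_x k (add_pos P.Tr_pos P.Ts_pos)).abs

theorem reachesStabilityOn (hd : ∀ k, ∀ t ≥ 0, |d t k| ≤ P.δ) {C : Set (Fin N)}
    (hC : ∀ k ∈ C, x (P.Tr + P.Ts) k = 0) : ReachesStabilityOn C x (P.Tr + P.Ts) := by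
  intro k hk
  refine ⟨?_, fun t ht => by rw [h.x_eq_terminal hd ht, hC k hk]⟩
  have := h.continuousAt_x k (add_pos P.Tr_pos P.Ts_pos)
  rwa [ContinuousAt, hC k hk] at this

theorem abs_terminal_le_leaderMax (hd : ∀ k, ∀ t ≥ 0, |d t k| ≤ P.δ) [NeZero N] (l : Fin N) :
    |x (P.Tr + P.Ts) l| ≤ G.leaderMax x (P.Tr + P.Ts) := by
  obtain ⟨b, hb, hmax⟩ :=
    SignedDigraph.exists_isLeader_forall_abs_le (h.signedLaplacian_mulVec_eq_zero hd)
  exact (hmax l).trans (SignedDigraph.abs_le_leaderMax x _ hb)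

theorem reachesBipartiteContainment [NeZero N] (hd : ∀ k, ∀ t ≥ 0, |d t k| ≤ P.δ) :
    ReachesBipartiteContainment G x (P.Tr + P.Ts) where
  balanced C hC _ := by
    obtain ⟨a, ha⟩ := hC.1.prop.1
    exact ⟨_, abs_nonneg _, h.reachesBipartiteConsensusOn hd fun k hk =>
      hC.abs_eq (fun i _ => congrFun (h.signedLaplacian_mulVec_eq_zero hd) i) hk ha⟩
  unbalanced C hC hub := h.reachesStabilityOn hd fun k hk =>
    hC.eq_zero_of_unbalanced hub (fun i _ => congrFun (h.signedLaplacian_mulVec_eq_zero hd) i) hk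
  follower_limit l _ := by
    have hcont := fun k => h.continuousAt_x k (add_pos P.Tr_pos P.Ts_pos)
    exact ⟨_, sub_nonneg.2 (h.abs_terminal_le_leaderMax hd l),
      (SignedDigraph.continuousAt_leaderMax hcont).sub (hcont l).abs⟩
  follower_mem l _ t ht := by
    have hmax : G.leaderMax x t = G.leaderMax x (P.Tr + P.Ts) := by
      simp only [SignedDigraph.leaderMax, h.x_eq_terminal hd ht]
    rw [hmax, h.x_eq_terminal hd ht]
    exact abs_le.1 (h.abs_terminal_le_leaderMax hd l)

end IsClosedLoopSolution

end SlidingModeDesign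

/-! ### Containment, consensus and stability -/

theorem theorem6 (N : ℕ) (hN : 2 ≤ N) (G : SignedDigraph N) (hG : G.WeaklyConnected) :
    ((∃ C, G.IsClosedStrongComponent C ∧ G.StructurallyBalancedOn C) →
      (∀ (P : SlidingModeDesign) (d x ς : ℝ → Fin N → ℝ),
        (∀ k, ∀ t ≥ 0, |d t k| ≤ P.δ) → P.IsClosedLoopSolution G d x ς →
        ReachesBipartiteContainment G x (P.Tr + P.Ts)) ∧
      (∀ C, G.IsClosedStrongComponent C → G.StructurallyBalancedOn C →
        ∃ Z : Submodule ℝ (Fin N → ℝ), Z ≠ ⊤ ∧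
          ∀ (P : SlidingModeDesign) (d x ς : ℝ → Fin N → ℝ),
            (∀ k, ∀ t ≥ 0, |d t k| ≤ P.δ) → P.IsClosedLoopSolution G d x ς → ς 0 ∉ Z →
            ∃ c > 0, ReachesBipartiteConsensusOn C x (P.Tr + P.Ts) c)) ∧
    ((∀ C, G.IsClosedStrongComponent C → ¬ G.StructurallyBalancedOn C) →
      ∀ (P : SlidingModeDesign) (d x ς : ℝ → Fin N → ℝ),
        (∀ k, ∀ t ≥ 0, |d t k| ≤ P.δ) → P.IsClosedLoopSolution G d x ς →
        ReachesStabilityOn Set.univ x (P.Tr + P.Ts)) := by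
  have : NeZero N := ⟨by omega⟩
  refine ⟨fun _ => ⟨fun P d x ς hd h => h.reachesBipartiteContainment hd, fun C hC hbal => ?_⟩,
    fun hub P d x ς hd h => h.reachesStabilityOn hd fun k _ => ?_⟩
  · obtain ⟨ν, hν, hoff, hνL⟩ := hC.exists_vecMul_eq_zero hbal
    have hmem : ∀ z, z ∈ LinearMap.ker (dotProductBilin ℝ ℝ ν) ↔ ∑ k, ν k * z k = 0 :=
      fun z => Iff.rfl
    refine ⟨LinearMap.ker (dotProductBilin ℝ ℝ ν), fun htop => hν ?_,
      fun P d x ς hd h h0 => ?_⟩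
    · have h0 := (hmem ν).1 (htop ▸ Submodule.mem_top)
      exact dotProduct_self_eq_zero.1 h0
    · obtain ⟨a, ha⟩ := hC.1.prop.1
      have habs : ∀ k ∈ C, |x (P.Tr + P.Ts) k| = |x (P.Tr + P.Ts) a| := fun k hk =>
        hC.abs_eq (fun i _ => congrFun (h.signedLaplacian_mulVec_eq_zero hd) i) hk ha
      refine ⟨_, abs_pos.2 fun hxa => h0 ?_, h.reachesBipartiteConsensusOn hd habs⟩
      rw [hmem, ← h.sum_mul_ς_terminal hνL]
      refine Finset.sum_eq_zero fun k _ => ?_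
      by_cases hk : k ∈ C
      · have hxk : x (P.Tr + P.Ts) k = 0 := by
          rw [← abs_eq_zero, habs k hk, hxa, abs_zero]
        have := h.sliding_eq_zero hd k (le_add_of_nonneg_right P.Ts_pos.le)
        rw [hxk, zero_eq_neg] at this
        rw [this, mul_zero]
      · rw [hoff k hk, zero_mul]
  · obtain ⟨b, ⟨C, hC, hbC⟩, hmax⟩ :=
      SignedDigraph.exists_isLeader_forall_abs_le (h.signedLaplacian_mulVec_eq_zero hd)
    have hb := hC.eq_zero_of_unbalanced (hub C hC)
      (fun i _ => congrFun (h.signedLaplacian_mulVec_eq_zero hd) i) hbC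
    simpa [hb] using hmax k
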